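/- For $a\in\mathbb C$ let $(a)_k=a(a+1)\cdots(a+k-1)$. For a nonnegative integer $n$ define the Hahn polynomials $$Q_n(x;\alpha,\beta,M)={}_3F_2\left(\begin{matrix}-n,\;n+\alpha+\beta+1,\;-x\\ \alpha+1,\;-M\end{matrix};1\right)=\sum_{k=0}^n\frac{(-n)_k(n+\alpha+\beta+1)_k(-x)_k}{(\alpha+1)_k(-M)_k\,k!}$$ and the Racah polynomials $R_n(t;\alpha,\beta,\gamma,\delta)$, polynomials in $t$, by $$R_n\big(y(y+\gamma+\delta+1);\alpha,\beta,\gamma,\delta\big)={}_4F_3\left(\begin{matrix}-n,\;n+\alpha+\beta+1,\;-y,\;y+\gamma+\delta+1\\ \alpha+1,\;\beta+\delta+1,\;\gamma+1\end{matrix};1\right)=\sum_{k=0}^n\frac{(-n)_k(n+\alpha+\beta+1)_k(-y)_k(y+\gamma+\delta+1)_k}{(\alpha+1)_k(\beta+\delta+1)_k(\gamma+1)_k\,k!}.$$ Let $N\in\{\tfrac12,1,\tfrac32,\ldots\}$ and $\alpha,x\in\mathbb C$. (i) If $n\in\{0,1,\ldots,\lfloor N+\tfrac12\rfloor\}$ and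 $\alpha\notin\{-1,-2,\ldots,-2n\}$, then $$Q_{2n}\big(x+N+\tfrac12;\alpha,\alpha,2N+1\big)=R_n\big(x^2-(N+\tfrac12)^2;\alpha,-\tfrac12,-N-1,-N-1\big).$$ (ii) If $n\in\{0,1,\ldots,\lfloor N\rfloor\}$ and $\alpha\notin\{-1,-2,\ldots,-2n-1\}$, then $$Q_{2n+1}\big(x+N+\tfrac12;\alpha,\alpha,2N+1\big)=-\frac{2x}{2N+1}\,R_n\big(x^2-(N+\tfrac12)^2;\alpha,\tfrac12,-N-1,-N-1\big).$$ -/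

import Mathlib

/-- The shifted factorial `(a)_k = a (a+1) ⋯ (a+k-1)`. -/
noncomputable def shiftedFactorial (a : ℂ) (k : ℕ) : ℂ :=
  (ascPochhammer ℂ k).eval a

/-- The terminating hypergeometric series with upper parameters `-n, a₁, …, aᵣ`, lower parameters
`b₁, …, bₛ` and argument `z`:
`∑_{k=0}^n (-n)_k (a₁)_k ⋯ (aᵣ)_k / ((b₁)_k ⋯ (bₛ)_k k!) z^k`.
It is meaningful when `(bⱼ)_k ≠ 0` for all `j` and all `k ≤ n`. -/
noncomputable def terminatingHyp (n : ℕ) (as bs : List ℂ) (z : ℂ) : ℂ :=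
  ∑ k ∈ Finset.range (n + 1),
    shiftedFactorial (-(n : ℂ)) k * (as.map fun a => shiftedFactorial a k).prod /
      ((bs.map fun b => shiftedFactorial b k).prod * (Nat.factorial k : ℂ)) * z ^ k

/-- Hahn polynomials `Q_n(x; α, β, N) = ₃F₂(-n, n+α+β+1, -x; α+1, -N; 1)`. -/
noncomputable def hahnQ (n : ℕ) (x α β N : ℂ) : ℂ :=
  terminatingHyp n [n + α + β + 1, -x] [α + 1, -N] 1

/-- Racah polynomials `R_n(t; α, β, γ, δ)` as functions of the variable `t`. They are determined by
`R_n(y(y+γ+δ+1); α, β, γ, δ) = ₄F₃(-n, n+α+β+1, -y, y+γ+δ+1; α+1, β+δ+1, γ+1; 1)`,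
see `racahR_quadratic` below; here `(-y)_k (y+γ+δ+1)_k` is written as the polynomial
`∏_{j<k} (j(j+γ+δ+1) - t)` in `t = y(y+γ+δ+1)`. -/
noncomputable def racahR (n : ℕ) (t α β γ δ : ℂ) : ℂ :=
  ∑ k ∈ Finset.range (n + 1),
    shiftedFactorial (-(n : ℂ)) k * shiftedFactorial (n + α + β + 1) k *
        (∏ j ∈ Finset.range k, ((j : ℂ) * (j + γ + δ + 1) - t)) /
      (shiftedFactorial (α + 1) k * shiftedFactorial (β + δ + 1) k * shiftedFactorial (γ + 1) k *
        (Nat.factorial k : ℂ))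

theorem shiftedFactorial_mul_eq_prod (y s : ℂ) (k : ℕ) :
    shiftedFactorial (-y) k * shiftedFactorial (y + s) k =
      ∏ j ∈ Finset.range k, ((j : ℂ) * (j + s) - y * (y + s)) := by
  induction k with
  | zero => simp [shiftedFactorial]
  | succ k ih =>
    rw [Finset.prod_range_succ, ← ih]
    simp only [shiftedFactorial, ascPochhammer_succ_eval]
    ring

/-- The defining hypergeometric formula of the Racah polynomials. -/
theorem racahR_quadratic (n : ℕ) (y α β γ δ : ℂ) :
    racahR n (y * (y + γ + δ + 1)) α β γ δ =
      terminatingHyp n [n + α + β + 1, -y, y + γ + δ + 1] [α + 1, β + δ + 1, γ + 1] 1 := by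
  unfold racahR terminatingHyp
  refine Finset.sum_congr rfl fun k _ => ?_
  have h := shiftedFactorial_mul_eq_prod y (γ + δ + 1) k
  simp only [← add_assoc] at h
  rw [← h]
  simp [mul_assoc]

/-! Put y = x + N + 1/2, c = N + 1/2, M = 2c. For d = 2n or 2n+1, both sides are polynomials in y of
degree at most d, equal to 1 at y = 0, and eigenfunctions of one second order difference operator
with eigenvalue d(d + 2α + 1). At y = 0 the coefficient of f(y - 1) vanishes, so the equation
determines f(1), ..., f(d) from f(0), and d + 1 values fix the polynomial
(`eq_of_hahnOperator_eigen_of_polynomial`). The eigenvalue equations hold because the operator is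
bidiagonal in (-y)_k (Hahn), in (-y)_k (y-M)_k (even Racah) and in y - c times the latter (odd
Racah); the hypergeometric coefficients satisfy exactly the resulting two-term recurrences. -/

lemma shiftedFactorial_zero (a : ℂ) : shiftedFactorial a 0 = 1 := by
  simp [shiftedFactorial]

lemma shiftedFactorial_succ (a : ℂ) (k : ℕ) :
    shiftedFactorial a (k + 1) = shiftedFactorial a k * (a + k) := by
  simp [shiftedFactorial, ascPochhammer_succ_eval]

lemma shiftedFactorial_succ_left (a : ℂ) (k : ℕ) :
    shiftedFactorial a (k + 1) = a * shiftedFactorial (a + 1) k := by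
  simp [shiftedFactorial, ascPochhammer_succ_left, Polynomial.eval_comp]

/-- Shifting the argument: `a (a+1)_k = (a)_k (a+k)`. -/
lemma mul_shiftedFactorial_add_one (a : ℂ) (k : ℕ) :
    a * shiftedFactorial (a + 1) k = shiftedFactorial a k * (a + k) := by
  rw [← shiftedFactorial_succ_left, shiftedFactorial_succ]

/-! ### The difference operator: eigenfunctions and their values -/

/-- The second order difference operator which has the symmetric Hahn polynomials
`Q_n(·; α, α, M)` as eigenfunctions. -/
noncomputable def hahnOperator (α M : ℂ) (f : ℂ → ℂ) (y : ℂ) : ℂ :=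
  (y + α + 1) * (y - M) * (f (y + 1) - f y) + y * (y - α - M - 1) * (f (y - 1) - f y)

/-- A linear combination `∑ a_k φ_k` of functions on which the operator acts bidiagonally is an
eigenfunction as soon as its coefficients satisfy the corresponding two-term recurrence. -/
lemma hahnOperator_sum_eigen (α M : ℂ) (φ : ℕ → ℂ → ℂ) (a μ e : ℕ → ℂ) (n : ℕ)
    (h0 : ∀ y, hahnOperator α M (φ 0) y = μ 0 * φ 0 y)
    (hs : ∀ k y, hahnOperator α M (φ (k + 1)) y = μ (k + 1) * φ (k + 1) y + e k * φ k y)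
    (ha : ∀ k < n, a k * (μ k - μ n) + a (k + 1) * e k = 0) (y : ℂ) :
    hahnOperator α M (fun y => ∑ k ∈ Finset.range (n + 1), a k * φ k y) y =
      μ n * ∑ k ∈ Finset.range (n + 1), a k * φ k y := by
  -- A truncated sum fails the eigenvalue equation only by its top term, and that defect vanishes at
  -- m = n.
  have key : ∀ m ≤ n, hahnOperator α M (fun y => ∑ k ∈ Finset.range (m + 1), a k * φ k y) y =
      μ n * (∑ k ∈ Finset.range (m + 1), a k * φ k y) + a m * (μ m - μ n) * φ m y := by
    intro m
    induction m with
    | zero =>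
      intro _
      have h := h0 y
      simp only [hahnOperator, zero_add, Finset.sum_range_one] at h ⊢
      linear_combination a 0 * h
    | succ m ih =>
      intro hm
      have h1 := ih (by omega)
      have h2 := hs m y
      have h3 := ha m (by omega)
      simp only [hahnOperator] at h1 h2 ⊢
      simp only [Finset.sum_range_succ _ (m + 1)]
      linear_combination h1 + a (m + 1) * h2 + φ m y * h3
  rw [key n le_rfl]
  ring

/-- The difference equation and the value at `0` determine the values at `0, …, d`. -/
lemma eq_of_hahnOperator_eigen {α M μ : ℂ} {f g : ℂ → ℂ} {d : ℕ}
    (hf : ∀ y, hahnOperator α M f y = μ * f y) (hg : ∀ y, hahnOperator α M g y = μ * g y)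
    (h0 : f 0 = g 0) (hα : ∀ k < d, (k : ℂ) + α + 1 ≠ 0) (hM : ∀ k < d, (k : ℂ) - M ≠ 0) :
    ∀ j ≤ d, f (j : ℂ) = g (j : ℂ) := by
  intro j
  induction j using Nat.strong_induction_on with
  | _ j ih =>
    intro hj
    rcases j with _ | j
    · simpa using h0
    have hj0 := ih j (by omega) (by omega)
    -- The factor j removes the unknown value at -1 when j = 0.
    have hD : (j : ℂ) * (f ((j : ℂ) - 1) - g ((j : ℂ) - 1)) = 0 := by
      rcases j with _ | i
      · simp
      · have hi := ih i (by omega) (by omega)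
        have : ((i + 1 : ℕ) : ℂ) - 1 = i := by push_cast; ring
        rw [this, hi, sub_self, mul_zero]
    have h1 := hf j
    have h2 := hg j
    simp only [hahnOperator] at h1 h2
    have h3 : (((j : ℂ) + α + 1) * ((j : ℂ) - M)) * (f ((j : ℂ) + 1) - g ((j : ℂ) + 1)) = 0 := by
      linear_combination h1 - h2 - ((j : ℂ) - α - M - 1) * hD +
        (μ + ((j : ℂ) + α + 1) * (j - M) + (j : ℂ) * (j - α - M - 1)) * hj0
    have h4 := (mul_eq_zero.mp h3).resolve_left
      (mul_ne_zero (hα j (by omega)) (hM j (by omega)))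
    push_cast
    exact sub_eq_zero.mp h4

/-! ### Polynomial functions and uniqueness -/

/-- Polynomial functions of degree at most `d`. -/
def IsPolynomialOfDegreeLE (d : ℕ) (f : ℂ → ℂ) : Prop :=
  ∃ p : Polynomial ℂ, p.natDegree ≤ d ∧ ∀ y, p.eval y = f y

namespace IsPolynomialOfDegreeLE

lemma const (d : ℕ) (a : ℂ) : IsPolynomialOfDegreeLE d fun _ => a :=
  ⟨Polynomial.C a, by simp, by simp⟩

lemma mono {d e : ℕ} {f : ℂ → ℂ} (h : IsPolynomialOfDegreeLE d f) (hde : d ≤ e) :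
    IsPolynomialOfDegreeLE e f := by
  obtain ⟨p, hp, hpf⟩ := h
  exact ⟨p, hp.trans hde, hpf⟩

lemma add {d : ℕ} {f g : ℂ → ℂ} (hf : IsPolynomialOfDegreeLE d f)
    (hg : IsPolynomialOfDegreeLE d g) : IsPolynomialOfDegreeLE d fun y => f y + g y := by
  obtain ⟨p, hp, hpf⟩ := hf
  obtain ⟨q, hq, hqg⟩ := hg
  exact ⟨p + q, Polynomial.natDegree_add_le_of_degree_le hp hq, by simp [hpf, hqg]⟩

lemma mul {d e : ℕ} {f g : ℂ → ℂ} (hf : IsPolynomialOfDegreeLE d f)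
    (hg : IsPolynomialOfDegreeLE e g) : IsPolynomialOfDegreeLE (d + e) fun y => f y * g y := by
  obtain ⟨p, hp, hpf⟩ := hf
  obtain ⟨q, hq, hqg⟩ := hg
  exact ⟨p * q, Polynomial.natDegree_mul_le_of_le hp hq, by simp [hpf, hqg]⟩

lemma sum {d n : ℕ} (a : ℕ → ℂ) (φ : ℕ → ℂ → ℂ)
    (h : ∀ k < n, IsPolynomialOfDegreeLE d (φ k)) :
    IsPolynomialOfDegreeLE d fun y => ∑ k ∈ Finset.range n, a k * φ k y := by
  induction n with
  | zero => simpa using const d 0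
  | succ n ih =>
    simp only [Finset.sum_range_succ]
    refine (ih fun k hk => h k (by omega)).add ?_
    simpa using (const 0 (a n)).mul (h n (by omega))

lemma linear (a b : ℂ) : IsPolynomialOfDegreeLE 1 fun y => a * y + b :=
  ⟨Polynomial.C a * Polynomial.X + Polynomial.C b, Polynomial.natDegree_linear_le, by simp⟩

lemma shiftedFactorial_linear (a b : ℂ) (k : ℕ) :
    IsPolynomialOfDegreeLE k fun y => shiftedFactorial (a * y + b) k := by
  induction k with
  | zero => simpa [shiftedFactorial_zero] using const 0 1
  | succ k ih =>
    simp only [shiftedFactorial_succ, add_assoc]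
    exact ih.mul (linear a (b + k))

lemma eq_of_eq_nat {d : ℕ} {f g : ℂ → ℂ} (hf : IsPolynomialOfDegreeLE d f)
    (hg : IsPolynomialOfDegreeLE d g) (h : ∀ j : ℕ, j ≤ d → f j = g j) : f = g := by
  obtain ⟨p, hp, hpf⟩ := hf
  obtain ⟨q, hq, hqg⟩ := hg
  have hpq : p = q := by
    refine Polynomial.eq_of_natDegree_lt_card_of_eval_eq p q
      (f := fun j : Fin (d + 1) => ((j : ℕ) : ℂ))
      (fun i j hij => Fin.ext (Nat.cast_injective hij)) (fun j => ?_) ?_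
    · rw [hpf, hqg, h j (by omega)]
    · rw [Fintype.card_fin]
      omega
  funext y
  rw [← hpf, ← hqg, hpq]

end IsPolynomialOfDegreeLE

/-- Uniqueness of polynomial eigenfunctions normalized at `0`. -/
lemma eq_of_hahnOperator_eigen_of_polynomial {α M μ : ℂ} {f g : ℂ → ℂ} {d : ℕ}
    (hfp : IsPolynomialOfDegreeLE d f) (hgp : IsPolynomialOfDegreeLE d g)
    (hf : ∀ y, hahnOperator α M f y = μ * f y) (hg : ∀ y, hahnOperator α M g y = μ * g y)
    (h0 : f 0 = g 0) (hα : ∀ k < d, (k : ℂ) + α + 1 ≠ 0) (hM : ∀ k < d, (k : ℂ) - M ≠ 0) :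
    f = g :=
  hfp.eq_of_eq_nat hgp (eq_of_hahnOperator_eigen hf hg h0 hα hM)

/-! ### Action of the operator on the three bases -/

lemma hahnOperator_shiftedFactorial (α M : ℂ) (k : ℕ) (y : ℂ) :
    hahnOperator α M (fun y => shiftedFactorial (-y) (k + 1)) y =
      ((k + 1 : ℕ) : ℂ) * ((k + 1 : ℕ) + 2 * α + 1) * shiftedFactorial (-y) (k + 1) +
        -((k + 1) * (k + α + 1) * (k - M)) * shiftedFactorial (-y) k := by
  have h1 : shiftedFactorial (-(y + 1)) (k + 1) = -(y + 1) * shiftedFactorial (-y) k := by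
    rw [shiftedFactorial_succ_left]; ring_nf
  have h2 : y * shiftedFactorial (-(y - 1)) (k + 1) =
      -(shiftedFactorial (-y) k * (-y + k) * (-y + (k + 1))) := by
    have h := mul_shiftedFactorial_add_one (-y) (k + 1)
    rw [shiftedFactorial_succ (-y)] at h
    push_cast at h
    rw [show -(y - 1) = -y + 1 by ring]
    linear_combination -h
  simp only [hahnOperator, h1, shiftedFactorial_succ (-y)]
  push_cast
  linear_combination (y - α - M - 1) * h2

/-- The product basis `(-y)_k (y-M)_k` of the polynomials symmetric under `y ↦ M - y`. -/
noncomputable def symmetricBasis (M : ℂ) (k : ℕ) (y : ℂ) : ℂ :=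
  shiftedFactorial (-y) k * shiftedFactorial (y - M) k

lemma symmetricBasis_zero (M y : ℂ) : symmetricBasis M 0 y = 1 := by
  simp [symmetricBasis, shiftedFactorial_zero]

lemma symmetricBasis_succ (M : ℂ) (k : ℕ) (y : ℂ) :
    symmetricBasis M (k + 1) y = symmetricBasis M k y * ((k - y) * (y - M + k)) := by
  simp only [symmetricBasis, shiftedFactorial_succ]
  ring

/-- The factor y - M, supplied by the operator's coefficient, restores the factor of (y-M)_k lost in
the shift and so avoids a division. -/
lemma symmetricBasis_succ_add_one (M : ℂ) (k : ℕ) (y : ℂ) :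
    (y - M) * symmetricBasis M (k + 1) (y + 1) =
      symmetricBasis M k y * ((y - M + k) * (-(y + 1)) * (y + 1 + k - M)) := by
  have h1 : shiftedFactorial (-(y + 1)) (k + 1) = -(y + 1) * shiftedFactorial (-y) k := by
    rw [shiftedFactorial_succ_left]; ring_nf
  have h2 := mul_shiftedFactorial_add_one (y - M) k
  have h3 : shiftedFactorial (y + 1 - M) (k + 1) =
      shiftedFactorial (y - M + 1) k * (y + 1 + k - M) := by
    rw [shiftedFactorial_succ, show y + 1 - M = y - M + 1 by ring]; ring
  simp only [symmetricBasis, h1, h3]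
  linear_combination -(y + 1) * shiftedFactorial (-y) k * (y + 1 + k - M) * h2

lemma symmetricBasis_succ_sub_one (M : ℂ) (k : ℕ) (y : ℂ) :
    y * symmetricBasis M (k + 1) (y - 1) =
      symmetricBasis M k y * ((y - k) * (y - M - 1) * (-y + 1 + k)) := by
  have h1 : shiftedFactorial (y - 1 - M) (k + 1) =
      (y - M - 1) * shiftedFactorial (y - M) k := by
    rw [shiftedFactorial_succ_left]; ring_nf
  have h2 := mul_shiftedFactorial_add_one (-y) k
  have h3 : shiftedFactorial (-(y - 1)) (k + 1) =
      shiftedFactorial (-y + 1) k * (-y + 1 + k) := by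
    rw [shiftedFactorial_succ, show -(y - 1) = -y + 1 by ring]
  simp only [symmetricBasis, h1, h3]
  linear_combination -(y - M - 1) * shiftedFactorial (y - M) k * (-y + 1 + k) * h2

lemma symmetricBasis_at_zero (M : ℂ) (k : ℕ) : symmetricBasis M (k + 1) 0 = 0 := by
  simp [symmetricBasis, shiftedFactorial_succ_left]

/-- Writing M = 2c splits the lower coefficient into linear factors in k; for c = N + 1/2 the last
two are the Racah factors k - 1/2 - N and k - N, which forces β = -1/2. -/
lemma hahnOperator_symmetricBasis (α c : ℂ) (k : ℕ) (y : ℂ) :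
    hahnOperator α (2 * c) (symmetricBasis (2 * c) (k + 1)) y =
      2 * ((k + 1 : ℕ) : ℂ) * (2 * (k + 1 : ℕ) + 2 * α + 1) * symmetricBasis (2 * c) (k + 1) y +
        -(4 * (k + 1) * (k + α + 1) * (k - c) * (k + 1 / 2 - c)) *
          symmetricBasis (2 * c) k y := by
  have h1 := symmetricBasis_succ_add_one (2 * c) k y
  have h2 := symmetricBasis_succ_sub_one (2 * c) k y
  simp only [hahnOperator, symmetricBasis_succ _ _ y]
  push_cast
  linear_combination (y + α + 1) * h1 + (y - α - 2 * c - 1) * h2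

/-- The factor y - c makes the basis odd under y ↦ 2c - y. It changes k - c to k + 1 - c, hence β =
1/2. -/
lemma hahnOperator_antisymmetricBasis (α c : ℂ) (k : ℕ) (y : ℂ) :
    hahnOperator α (2 * c) (fun y => (y - c) * symmetricBasis (2 * c) (k + 1) y) y =
      (2 * ((k + 1 : ℕ) : ℂ) + 1) * (2 * (k + 1 : ℕ) + 2 * α + 2) *
          ((y - c) * symmetricBasis (2 * c) (k + 1) y) +
        -(4 * (k + 1) * (k + α + 1) * (k + 1 - c) * (k + 1 / 2 - c)) *
          ((y - c) * symmetricBasis (2 * c) k y) := by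
  have h1 := symmetricBasis_succ_add_one (2 * c) k y
  have h2 := symmetricBasis_succ_sub_one (2 * c) k y
  simp only [hahnOperator, symmetricBasis_succ _ _ y]
  push_cast
  linear_combination (y + α + 1) * (y + 1 - c) * h1 + (y - α - 2 * c - 1) * (y - 1 - c) * h2

lemma isPolynomialOfDegreeLE_symmetricBasis (M : ℂ) (k : ℕ) :
    IsPolynomialOfDegreeLE (2 * k) (symmetricBasis M k) := by
  have h1 := IsPolynomialOfDegreeLE.shiftedFactorial_linear (-1) 0 k
  have h2 := IsPolynomialOfDegreeLE.shiftedFactorial_linear 1 (-M) k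
  simpa [symmetricBasis, funext_iff, two_mul, sub_eq_add_neg, IsPolynomialOfDegreeLE]
    using h1.mul h2

/-! ### Coefficient recurrences and difference equations -/

/-- The coefficient of a terminating hypergeometric series with two numerator parameters `-n`, `b`
and three denominator parameters. -/
noncomputable def racahCoeff (n : ℕ) (b p q r : ℂ) (k : ℕ) : ℂ :=
  shiftedFactorial (-(n : ℂ)) k * shiftedFactorial b k /
    (shiftedFactorial p k * shiftedFactorial q k * shiftedFactorial r k * (Nat.factorial k : ℂ))

/-- The coefficient of a terminating hypergeometric series with two numerator parameters `-n`, `b`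
and two denominator parameters. -/
noncomputable def hahnCoeff (n : ℕ) (b p q : ℂ) (k : ℕ) : ℂ :=
  shiftedFactorial (-(n : ℂ)) k * shiftedFactorial b k /
    (shiftedFactorial p k * shiftedFactorial q k * (Nat.factorial k : ℂ))

lemma racahCoeff_zero (n : ℕ) (b p q r : ℂ) : racahCoeff n b p q r 0 = 1 := by
  simp [racahCoeff, shiftedFactorial_zero]

lemma hahnCoeff_zero (n : ℕ) (b p q : ℂ) : hahnCoeff n b p q 0 = 1 := by
  simp [hahnCoeff, shiftedFactorial_zero]

/-- Only the newly added denominator factors are cancelled; the old denominator stays on both sides,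
so it need not be nonzero. -/
lemma racahCoeff_succ (n : ℕ) (b : ℂ) {p q r : ℂ} {k : ℕ} (hp : p + k ≠ 0) (hq : q + k ≠ 0)
    (hr : r + k ≠ 0) :
    racahCoeff n b p q r (k + 1) * ((k + 1) * (p + k) * (q + k) * (r + k)) =
      racahCoeff n b p q r k * ((k - n) * (b + k)) := by
  have hk : (k : ℂ) + 1 ≠ 0 := Nat.cast_add_one_ne_zero k
  have hu : (k + 1) * (p + k) * (q + k) * (r + k) ≠ 0 := by simp [hp, hq, hr, hk]
  simp only [racahCoeff, shiftedFactorial_succ, Nat.factorial_succ]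
  push_cast
  rw [show shiftedFactorial p k * (p + k) * (shiftedFactorial q k * (q + k)) *
      (shiftedFactorial r k * (r + k)) * ((k + 1) * (Nat.factorial k : ℂ)) =
      (shiftedFactorial p k * shiftedFactorial q k * shiftedFactorial r k *
        (Nat.factorial k : ℂ)) * ((k + 1) * (p + k) * (q + k) * (r + k)) by ring,
    ← div_div, div_mul_cancel₀ _ hu]
  ring

lemma hahnCoeff_succ (n : ℕ) (b : ℂ) {p q : ℂ} {k : ℕ} (hp : p + k ≠ 0) (hq : q + k ≠ 0) :
    hahnCoeff n b p q (k + 1) * ((k + 1) * (p + k) * (q + k)) =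
      hahnCoeff n b p q k * ((k - n) * (b + k)) := by
  have hk : (k : ℂ) + 1 ≠ 0 := Nat.cast_add_one_ne_zero k
  have hu : (k + 1) * (p + k) * (q + k) ≠ 0 := by simp [hp, hq, hk]
  simp only [hahnCoeff, shiftedFactorial_succ, Nat.factorial_succ]
  push_cast
  rw [show shiftedFactorial p k * (p + k) * (shiftedFactorial q k * (q + k)) *
      ((k + 1) * (Nat.factorial k : ℂ)) =
      (shiftedFactorial p k * shiftedFactorial q k * (Nat.factorial k : ℂ)) *
        ((k + 1) * (p + k) * (q + k)) by ring,
    ← div_div, div_mul_cancel₀ _ hu]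
  ring

lemma hahnQ_eq_sum (d : ℕ) (y α M : ℂ) :
    hahnQ d y α α M = ∑ k ∈ Finset.range (d + 1),
      hahnCoeff d (d + α + α + 1) (α + 1) (-M) k * shiftedFactorial (-y) k := by
  unfold hahnQ terminatingHyp hahnCoeff
  refine Finset.sum_congr rfl fun k _ => ?_
  simp
  ring

lemma racahR_eq_sum (n : ℕ) (y α β N : ℂ) :
    racahR n ((y - (N + 1 / 2)) ^ 2 - (N + 1 / 2) ^ 2) α β (-N - 1) (-N - 1) =
      ∑ k ∈ Finset.range (n + 1),
        racahCoeff n (n + α + β + 1) (α + 1) (β - N) (-N) k *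
          symmetricBasis (2 * (N + 1 / 2)) k y := by
  rw [show (y - (N + 1 / 2)) ^ 2 - (N + 1 / 2) ^ 2 = y * (y + (-N - 1) + (-N - 1) + 1) by ring,
    racahR_quadratic]
  unfold terminatingHyp racahCoeff symmetricBasis
  refine Finset.sum_congr rfl fun k _ => ?_
  rw [show y - 2 * (N + 1 / 2) = y + (-N - 1) + (-N - 1) + 1 by ring,
    show β - N = β + (-N - 1) + 1 by ring, show -N = -N - 1 + 1 by ring]
  simp
  ring

lemma isPolynomialOfDegreeLE_hahnQ (d : ℕ) (α M : ℂ) :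
    IsPolynomialOfDegreeLE d fun y => hahnQ d y α α M := by
  simp only [hahnQ_eq_sum]
  refine IsPolynomialOfDegreeLE.sum _ (fun k y => shiftedFactorial (-y) k) fun k hk => ?_
  have h := (IsPolynomialOfDegreeLE.shiftedFactorial_linear (-1) 0 k).mono
    (Nat.le_of_lt_succ hk)
  simpa using h

lemma hahnQ_at_zero (d : ℕ) (α M : ℂ) : hahnQ d 0 α α M = 1 := by
  rw [hahnQ_eq_sum, Finset.sum_range_succ', Finset.sum_eq_zero]
  · simp [hahnCoeff_zero, shiftedFactorial_zero]
  · intro k _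
    simp [shiftedFactorial_succ_left]

/-- The difference equation of the symmetric Hahn polynomials. -/
lemma hahnOperator_hahnQ {α M : ℂ} {d : ℕ} (hα : ∀ k < d, (k : ℂ) + α + 1 ≠ 0)
    (hM : ∀ k < d, (k : ℂ) - M ≠ 0) (y : ℂ) :
    hahnOperator α M (fun y => hahnQ d y α α M) y =
      d * (d + 2 * α + 1) * hahnQ d y α α M := by
  simp only [hahnQ_eq_sum]
  refine hahnOperator_sum_eigen α M (fun k y => shiftedFactorial (-y) k) _
    (fun k => k * (k + 2 * α + 1)) (fun k => -((k + 1) * (k + α + 1) * (k - M))) d ?_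
    (hahnOperator_shiftedFactorial α M) ?_ y
  · intro y
    simp [hahnOperator, shiftedFactorial_zero]
  · intro k hk
    have h := hahnCoeff_succ d (d + α + α + 1) (p := α + 1) (q := -M) (k := k)
      (fun h => hα k hk (by linear_combination h)) (fun h => hM k hk (by linear_combination h))
    linear_combination -h

lemma racahR_at_zero (n : ℕ) (α β N : ℂ) :
    racahR n ((0 - (N + 1 / 2)) ^ 2 - (N + 1 / 2) ^ 2) α β (-N - 1) (-N - 1) = 1 := by
  rw [racahR_eq_sum, Finset.sum_range_succ', Finset.sum_eq_zero]
  · simp [racahCoeff_zero, symmetricBasis_zero]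
  · intro k _
    simp [symmetricBasis_at_zero]

lemma isPolynomialOfDegreeLE_racahR (n : ℕ) (α β N : ℂ) :
    IsPolynomialOfDegreeLE (2 * n) fun y =>
      racahR n ((y - (N + 1 / 2)) ^ 2 - (N + 1 / 2) ^ 2) α β (-N - 1) (-N - 1) := by
  simp only [racahR_eq_sum]
  exact IsPolynomialOfDegreeLE.sum _ _ fun k hk =>
    (isPolynomialOfDegreeLE_symmetricBasis _ k).mono (by omega)

/-- The difference equation of the Racah polynomials with `β = -1/2`, `γ = δ = -N-1`. -/
lemma hahnOperator_racahR_even {α N : ℂ} {n : ℕ} (hα : ∀ k < n, (k : ℂ) + α + 1 ≠ 0)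
    (hN : ∀ k < n, (k : ℂ) - N ≠ 0) (hN' : ∀ k < n, (k : ℂ) - 1 / 2 - N ≠ 0) (y : ℂ) :
    hahnOperator α (2 * (N + 1 / 2)) (fun y =>
        racahR n ((y - (N + 1 / 2)) ^ 2 - (N + 1 / 2) ^ 2) α (-(1 / 2)) (-N - 1) (-N - 1)) y =
      2 * n * (2 * n + 2 * α + 1) *
        racahR n ((y - (N + 1 / 2)) ^ 2 - (N + 1 / 2) ^ 2) α (-(1 / 2)) (-N - 1) (-N - 1) := by
  simp only [racahR_eq_sum]
  refine hahnOperator_sum_eigen α _ (symmetricBasis (2 * (N + 1 / 2))) _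
    (fun k => 2 * k * (2 * k + 2 * α + 1)) _ n ?_
    (hahnOperator_symmetricBasis α (N + 1 / 2)) ?_ y
  · intro y
    simp [hahnOperator, symmetricBasis_zero]
  · intro k hk
    have h := racahCoeff_succ n (n + α + -(1 / 2) + 1) (p := α + 1) (q := -(1 / 2) - N) (r := -N)
      (k := k) (fun h => hα k hk (by linear_combination h))
      (fun h => hN' k hk (by linear_combination h)) (fun h => hN k hk (by linear_combination h))
    -- The eigenvalue difference is 4(k - n)(k + n + α + 1/2).
    linear_combination -4 * h

/-- The difference equation of `y - N - 1/2` times the Racah polynomials with `β = 1/2`,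
`γ = δ = -N-1`. -/
lemma hahnOperator_racahR_odd {α N : ℂ} {n : ℕ} (hα : ∀ k < n, (k : ℂ) + α + 1 ≠ 0)
    (hN : ∀ k < n, (k : ℂ) - N ≠ 0) (hN' : ∀ k < n, (k : ℂ) + 1 / 2 - N ≠ 0) (y : ℂ) :
    hahnOperator α (2 * (N + 1 / 2)) (fun y => (y - (N + 1 / 2)) *
        racahR n ((y - (N + 1 / 2)) ^ 2 - (N + 1 / 2) ^ 2) α (1 / 2) (-N - 1) (-N - 1)) y =
      (2 * n + 1) * (2 * n + 2 * α + 2) * ((y - (N + 1 / 2)) *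
        racahR n ((y - (N + 1 / 2)) ^ 2 - (N + 1 / 2) ^ 2) α (1 / 2) (-N - 1) (-N - 1)) := by
  simp only [racahR_eq_sum, Finset.mul_sum, mul_left_comm (_ - (N + 1 / 2))]
  -- Pulls the eigenvalue back out of the right-hand sum.
  rw [← Finset.mul_sum]
  refine hahnOperator_sum_eigen α _
    (fun k y => (y - (N + 1 / 2)) * symmetricBasis (2 * (N + 1 / 2)) k y) _
    (fun k => (2 * k + 1) * (2 * k + 2 * α + 2)) _ n ?_
    (hahnOperator_antisymmetricBasis α (N + 1 / 2)) ?_ y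
  · intro y
    simp only [hahnOperator, symmetricBasis_zero]
    push_cast
    ring
  · intro k hk
    have h := racahCoeff_succ n (n + α + 1 / 2 + 1) (p := α + 1) (q := 1 / 2 - N) (r := -N)
      (k := k) (fun h => hα k hk (by linear_combination h))
      (fun h => hN' k hk (by linear_combination h)) (fun h => hN k hk (by linear_combination h))
    linear_combination -4 * h

/-! ### The quadratic transformations -/

theorem mainTheorem7 (N : ℝ) (hN : ∃ m : ℕ, 1 ≤ m ∧ N = (m : ℝ) / 2) (n : ℕ) (α x : ℂ) :
    (n ≤ ⌊N + 1 / 2⌋₊ → (∀ k ∈ Finset.Icc 1 (2 * n), α ≠ -(k : ℂ)) →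
      hahnQ (2 * n) (x + N + 1 / 2) α α (2 * N + 1) =
        racahR n (x ^ 2 - ((N : ℂ) + 1 / 2) ^ 2) α (-(1 / 2)) (-N - 1) (-N - 1)) ∧
    (n ≤ ⌊N⌋₊ → (∀ k ∈ Finset.Icc 1 (2 * n + 1), α ≠ -(k : ℂ)) →
      hahnQ (2 * n + 1) (x + N + 1 / 2) α α (2 * N + 1) =
        -(2 * x) / (2 * N + 1) *
          racahR n (x ^ 2 - ((N : ℂ) + 1 / 2) ^ 2) α (1 / 2) (-N - 1) (-N - 1)) := by
  obtain ⟨m, hm, hNm⟩ := hN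
  have hNC : 2 * (N : ℂ) = (m : ℂ) := by
    rw [hNm]; push_cast; ring
  have hN0 : 0 ≤ N := by rw [hNm]; positivity
  have hM : 2 * (N : ℂ) + 1 = 2 * ((N : ℂ) + 1 / 2) := by ring
  have ne_of_nat : ∀ {a b : ℕ}, a ≠ b → (a : ℂ) ≠ (b : ℂ) := fun h => Nat.cast_injective.ne h
  rw [hM]
  constructor
  · intro hn hα
    have hn2 : 2 * n ≤ m + 1 := by
      have h := (Nat.le_floor_iff (by positivity)).mp hn
      have : (2 * n : ℝ) ≤ m + 1 := by rw [hNm] at h; linarith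
      exact_mod_cast this
    have hα' : ∀ k < 2 * n, (k : ℂ) + α + 1 ≠ 0 := fun k hk h =>
      hα (k + 1) (Finset.mem_Icc.mpr ⟨by omega, by omega⟩)
        (by push_cast; linear_combination h)
    -- Here M = m + 1 ≥ 2n, so the zero of k - M lies outside the range.
    have hMk : ∀ k < 2 * n, (k : ℂ) - 2 * ((N : ℂ) + 1 / 2) ≠ 0 := fun k hk h =>
      ne_of_nat (show k ≠ m + 1 by omega) (by push_cast; linear_combination h + hNC)
    have key := eq_of_hahnOperator_eigen_of_polynomial
      (isPolynomialOfDegreeLE_hahnQ (2 * n) α (2 * ((N : ℂ) + 1 / 2)))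
      (isPolynomialOfDegreeLE_racahR n α (-(1 / 2)) N)
      (hahnOperator_hahnQ hα' hMk)
      (fun y => by
        rw [hahnOperator_racahR_even (fun k hk => hα' k (by omega))
          (fun k hk h => ne_of_nat (show 2 * k ≠ m by omega)
            (by push_cast; linear_combination 2 * h + hNC))
          (fun k hk h => ne_of_nat (show 2 * k ≠ m + 1 by omega)
            (by push_cast; linear_combination 2 * h + hNC))]
        push_cast
        ring)
      (by rw [hahnQ_at_zero, racahR_at_zero]) hα' hMk
    have h := congrFun key (x + N + 1 / 2)
    rw [h, show x + (N : ℂ) + 1 / 2 - (N + 1 / 2) = x by ring]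
  · intro hn hα
    have hn2 : 2 * n ≤ m := by
      have h := (Nat.le_floor_iff hN0).mp hn
      have : (2 * n : ℝ) ≤ m := by rw [hNm] at h; linarith
      exact_mod_cast this
    have hα' : ∀ k < 2 * n + 1, (k : ℂ) + α + 1 ≠ 0 := fun k hk h =>
      hα (k + 1) (Finset.mem_Icc.mpr ⟨by omega, by omega⟩)
        (by push_cast; linear_combination h)
    have hMk : ∀ k < 2 * n + 1, (k : ℂ) - 2 * ((N : ℂ) + 1 / 2) ≠ 0 := fun k hk h =>
      ne_of_nat (show k ≠ m + 1 by omega) (by push_cast; linear_combination h + hNC)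
    have hc : (N : ℂ) + 1 / 2 ≠ 0 := fun h =>
      ne_of_nat (show m + 1 ≠ 0 by omega) (by push_cast; linear_combination 2 * h - hNC)
    have hlin := IsPolynomialOfDegreeLE.linear 1 (-((N : ℂ) + 1 / 2))
    simp only [one_mul, ← sub_eq_add_neg] at hlin
    -- The constant -1/c normalizes (y - c) R_n to 1 at y = 0; it becomes the prefactor -2x/(2N+1).
    have hR := (IsPolynomialOfDegreeLE.const 0 (-((N : ℂ) + 1 / 2)⁻¹)).mul
      (hlin.mul (isPolynomialOfDegreeLE_racahR n α (1 / 2) N))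
    have key := eq_of_hahnOperator_eigen_of_polynomial
      (isPolynomialOfDegreeLE_hahnQ (2 * n + 1) α (2 * ((N : ℂ) + 1 / 2)))
      (hR.mono (by omega))
      (hahnOperator_hahnQ hα' hMk)
      (fun y => by
        have h := hahnOperator_racahR_odd (n := n) (N := N) (fun k hk => hα' k (by omega))
          (fun k hk h => ne_of_nat (show 2 * k ≠ m by omega)
            (by push_cast; linear_combination 2 * h + hNC))
          (fun k hk h => ne_of_nat (show 2 * k + 1 ≠ m by omega)
            (by push_cast; linear_combination 2 * h + hNC)) y
        simp only [hahnOperator] at h ⊢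
        push_cast
        linear_combination -((N : ℂ) + 1 / 2)⁻¹ * h)
      (by
        rw [hahnQ_at_zero, racahR_at_zero]
        linear_combination -inv_mul_cancel₀ hc) hα' hMk
    have h := congrFun key (x + N + 1 / 2)
    rw [h, show x + (N : ℂ) + 1 / 2 - (N + 1 / 2) = x by ring, neg_div,
      mul_div_mul_left x _ two_ne_zero]
    ring
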